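/- **Theorem (Soundness of the parallel composition rule).** For every parallel event system $\mathcal{PS}$ and every rely-guarantee specification $\langle pre,R,G,pst\rangle$, if $\vdash \mathcal{PS}\ \mathbf{sat}\ \langle pre,R,G,pst\rangle$ is derivable in the proof system below, then $\mathcal{PS}$ satisfies it: $\models \mathcal{PS}\ \mathbf{sat}\ \langle pre,R,G,pst\rangle$. **Syntax.** Fix arbitrary sets of states $S$, parameters $\Lambda$ and labels $\mathcal K$. Let $f:S\to S$, $b\subseteq S$, $r\subseteq S\times S$. - Programs: $P ::= \mathsf{Basic}\,f \mid P_1;P_2 \mid \mathsf{Cond}\,b\,P_1\,P_2 \mid \mathsf{While}\,b\,P \mid \mathsf{Await}\,b\,P \mid \mathsf{Nondt}\,r$. - Events: $\mathcal E ::= \mathsf{Event}\,\alpha \mid \lfloor P\rfloor$, where $\alpha:\Lambda\times\mathcal K\to 2^S\times\mathrm{Prog}$ gives a guard $\mathrm{fst}(\alpha(p,\kappa))$ and a body $\mathrm{snd}(\alpha(p,\kappa))$; in $\lfloor P\rfloor$, $P$ is a program or the terminated program $\mathsf{None}$. - Event systems: $\mathcal S ::= \{\mathcal E_0,\dots,\mathcal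 E_n\} \mid \mathcal E;\mathcal S$. - A parallel event system is a function $\mathcal{PS}$ from $\mathcal K$ to event systems. **Semantics.** A configuration is $(\sharp,s,x)$: a specification $\sharp$ (one of the above, or $\mathsf{None}$ at program level), a state $s\in S$ and an event context $x:\mathcal K\to\mathcal E$. An environment transition $(\sharp,s,x)\xrightarrow{e}(\sharp,s',x')$ changes $s$ and $x$ arbitrarily and keeps $\sharp$. Action transitions are generated by the following rules. - Programs: $(\mathsf{Basic}\,f,s,x)\xrightarrow{c}(\mathsf{None},f\,s,x)$. If $(P_1,s,x)\xrightarrow{c}(\mathsf{None},s',x)$ then $(P_1;P_2,s,x)\xrightarrow{c}(P_2,s',x)$. If $(P_1,s,x)\xrightarrow{c}(P_1',s',x)$ with $P_1'\neq\mathsf{None}$ then $(P_1;P_2,s,x)\xrightarrow{c}(P_1';P_2,s',x)$. $(\mathsf{Cond}\,b\,P_1\,P_2,s,x)\xrightarrow{c}(P_1,s,x)$ if $s\in b$, and $\xrightarrow{c}(P_2,s,x)$ if $s\notin b$. $(\mathsf{While}\,b\,P,s,x)\xrightarrow{c}(P;\mathsf{While}\,b\,P,s,x)$ if $s\in b$,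 and $\xrightarrow{c}(\mathsf{None},s,x)$ if $s\notin b$. $(\mathsf{Await}\,b\,P,s,x)\xrightarrow{c}(\mathsf{None},s',x)$ if $s\in b$ and $(P,s,x)\xrightarrow{c}{}^{*}(\mathsf{None},s',x)$, where $^*$ is reflexive transitive closure. $(\mathsf{Nondt}\,r,s,x)\xrightarrow{c}(\mathsf{None},s',x)$ if $(s,s')\in r$. - Events: if $(P,s,x)\xrightarrow{c}(P',s',x)$ then $(\lfloor P\rfloor,s,x)\xrightarrow{c@\kappa}(\lfloor P'\rfloor,s',x)$ for every $\kappa$. If $s\in\mathrm{fst}(\alpha(p,\kappa))$ then $(\mathsf{Event}\,\alpha,s,x)\xrightarrow{\mathsf{Event}\,\alpha@\kappa}(\lfloor \mathrm{snd}(\alpha(p,\kappa))\rfloor,s,x(\kappa\mapsto\mathsf{Event}\,\alpha))$. - Event systems: with $\mathcal S_0=\{\mathcal E_0,\dots,\mathcal E_n\}$, if $(\mathcal E_i,s,x)\xrightarrow{\mathcal E_i@\kappa}(\mathcal E_i',s,x')$ then $(\mathcal S_0,s,x)\xrightarrow{\mathcal E_i@\kappa}(\mathcal E_i';\mathcal S_0,s,x')$.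 If $(\mathcal E,s,x)\xrightarrow{t@\kappa}(\mathcal E',s',x')$ then $(\mathcal E;\mathcal S,s,x)\xrightarrow{t@\kappa}(\mathcal E';\mathcal S,s',x')$, and if moreover $\mathcal E'=\lfloor\mathsf{None}\rfloor$ then also $(\mathcal E;\mathcal S,s,x)\xrightarrow{t@\kappa}(\mathcal S,s',x')$. - Parallel: if $(\mathcal{PS}(\kappa),s,x)\xrightarrow{t@\kappa}(\mathcal S',s',x')$ then $(\mathcal{PS},s,x)\xrightarrow{t@\kappa}(\mathcal{PS}(\kappa\mapsto\mathcal S'),s',x')$. **Validity.** A computation is a finite nonempty list $\varpi$ of configurations in which any two consecutive ones are related by an environment or an action transition; $\Psi(\mathcal{PS},s,x)$ is the set of computations with $\varpi_0=(\mathcal{PS},s,x)$. A specification consists of $pre,pst\subseteq S$ and $R,G\subseteq S\times S$. Let $A(pre,R)$ be the set of $\varpi$ with $s_{\varpi_0}\in pre$ and $(s_{\varpi_i},s_{\varpi_{i+1}})\in R$ whenever $i<len(\varpi)-1$ and $\varpi_i\xrightarrow{e}\varpi_{i+1}$. For parallel event systems, which are regarded as running forever, let $C(G,pst)$ be the set of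 $\varpi$ with $(s_{\varpi_i},s_{\varpi_{i+1}})\in G$ whenever $i<len(\varpi)-1$ and $\varpi_i\xrightarrow{\delta}\varpi_{i+1}$ for some action label $\delta$; there is no condition on the final state. Then $\models\mathcal{PS}\ \mathbf{sat}\ \langle pre,R,G,pst\rangle$ means $\Psi(\mathcal{PS},s,x)\cap A(pre,R)\subseteq C(G,pst)$ for all $s$ and $x$. **Proof system.** $stable(q,R)$ means: $s\in q$ and $(s,s')\in R$ imply $s'\in q$. Write $\mathrm{Id}=\{(s,s)\mid s\in S\}$. Derivability is the least relation closed under the following rules. - Basic: $\vdash\mathsf{Basic}\,f\ \mathbf{sat}\ \langle pre,R,G,pst\rangle$ if $pre\subseteq\{s\mid f(s)\in pst\}$, $stable(pre,R)$, $stable(pst,R)$ and $\{(s,s')\mid s\in pre\wedge(s'=f(s)\vee s'=s)\}\subseteq G$. - Seq: from $\vdash P\ \mathbf{sat}\ \langle pre,R,G,m\rangle$ and $\vdash Q\ \mathbf{sat}\ \langle m,R,G,pst\rangle$ infer $\vdash P;Q\ \mathbf{sat}\ \langle pre,R,G,pst\rangle$. - Cond: from $\vdash P_1\ \mathbf{sat}\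 \langle pre\cap b,R,G,pst\rangle$, $\vdash P_2\ \mathbf{sat}\ \langle pre\setminus b,R,G,pst\rangle$, $stable(pre,R)$ and $\mathrm{Id}\subseteq G$ infer $\vdash\mathsf{Cond}\,b\,P_1\,P_2\ \mathbf{sat}\ \langle pre,R,G,pst\rangle$. - While: from $\vdash P\ \mathbf{sat}\ \langle pre\cap b,R,G,pre\rangle$, $stable(pre,R)$, $pre\setminus b\subseteq pst$, $stable(pst,R)$ and $\mathrm{Id}\subseteq G$ infer $\vdash\mathsf{While}\,b\,P\ \mathbf{sat}\ \langle pre,R,G,pst\rangle$. - Await: from $\vdash P\ \mathbf{sat}\ \langle pre\cap b\cap\{V\},\mathrm{Id},S\times S,\{s\mid(V,s)\in G\}\cap pst\rangle$ for all $V\in S$, $stable(pre,R)$ and $stable(pst,R)$ infer $\vdash\mathsf{Await}\,b\,P\ \mathbf{sat}\ \langle pre,R,G,pst\rangle$. - Nondt: $\vdash\mathsf{Nondt}\,r\ \mathbf{sat}\ \langle pre,R,G,pst\rangle$ if every $s\in pre$ has some $s'$ with $(s,s')\in r$ and all such $s'$ lie in $pst$, $\{(s,s')\in r\mid s\in pre\}\subseteq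 G$, $stable(pre,R)$ and $stable(pst,R)$. - AnonyEvt: from $\vdash P\ \mathbf{sat}\ \langle pre,R,G,pst\rangle$ infer $\vdash\lfloor P\rfloor\ \mathbf{sat}\ \langle pre,R,G,pst\rangle$ ($P$ a program). - BasicEvt: from $\vdash\mathrm{snd}(\alpha(p,\kappa))\ \mathbf{sat}\ \langle pre\cap\mathrm{fst}(\alpha(p,\kappa)),R,G,pst\rangle$ for all $p,\kappa$, $stable(pre,R)$ and $\mathrm{Id}\subseteq G$ infer $\vdash\mathsf{Event}\,\alpha\ \mathbf{sat}\ \langle pre,R,G,pst\rangle$. - EvtSeq: from $\vdash\mathcal E\ \mathbf{sat}\ \langle pre,R,G,m\rangle$ and $\vdash\mathcal S\ \mathbf{sat}\ \langle m,R,G,pst\rangle$ infer $\vdash\mathcal E;\mathcal S\ \mathbf{sat}\ \langle pre,R,G,pst\rangle$. - EvtSet: from $\vdash\mathcal E_i\ \mathbf{sat}\ \langle pres_i,Rs_i,Gs_i,psts_i\rangle$, $pre\subseteq pres_i$, $R\subseteq Rs_i$, $Gs_i\subseteq G$, $psts_i\subseteq pst$ and $psts_i\subseteq pres_j$ for all $i,j\le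 n$, together with $stable(pre,R)$ and $\mathrm{Id}\subseteq G$, infer $\vdash\{\mathcal E_0,\dots,\mathcal E_n\}\ \mathbf{sat}\ \langle pre,R,G,pst\rangle$. - Par: from $\vdash\mathcal{PS}(\kappa)\ \mathbf{sat}\ \langle pres_\kappa,Rs_\kappa,Gs_\kappa,psts_\kappa\rangle$, $pre\subseteq pres_\kappa$, $R\subseteq Rs_\kappa$, $Gs_\kappa\subseteq G$ and $psts_\kappa\subseteq pst$ for all $\kappa$, and $Gs_\kappa\subseteq Rs_{\kappa'}$ for all $\kappa\ne\kappa'$, infer $\vdash\mathcal{PS}\ \mathbf{sat}\ \langle pre,R,G,pst\rangle$. - Conseq (at each of the four levels): from $pre\subseteq pre'$, $R\subseteq R'$, $G'\subseteq G$, $pst'\subseteq pst$ and $\vdash\sharp\ \mathbf{sat}\ \langle pre',R',G',pst'\rangle$ infer $\vdash\sharp\ \mathbf{sat}\ \langle pre,R,G,pst\rangle$. -/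

import Mathlib

namespace EventLang

/-! ### Abstract syntax -/

/-- Programs over a state space `S`; boolean conditions are sets of states. -/
inductive Prog (S : Type*)
  | basic (f : S → S)
  | seq (P₁ P₂ : Prog S)
  | cond (b : Set S) (P₁ P₂ : Prog S)
  | while (b : Set S) (P : Prog S)
  | await (b : Set S) (P : Prog S)
  | nondt (r : Set (S × S))

/-- Events, with parameters in `Λ` and event-system labels in `K`.  A basic event is given by a map
sending parameters and a label to a guard and a body.  An anonymous event wraps a program or the
terminated program `none`. -/
inductive Event (S K Λ : Type*)
  | basic (α : Λ × K → Set S × Prog S)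
  | anon (P : Option (Prog S))

/-- Event systems: a finite nonempty event set `{E₀, …, Eₙ}`, or an event sequence `E ; 𝒮`. -/
inductive EventSys (S K Λ : Type*)
  | evtSet (n : ℕ) (E : Fin (n + 1) → Event S K Λ)
  | evtSeq (E : Event S K Λ) (𝒮 : EventSys S K Λ)

/-- Parallel event systems. -/
abbrev ParSys (S K Λ : Type*) := K → EventSys S K Λ

/-! ### Operational semantics -/

/-- A configuration `(♯, s, x)`: specification, state, event context. -/
@[ext] structure Config (Spec S X : Type*) where
  spec : Spec
  state : S
  ctx : X

/-- Event contexts. -/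
abbrev Ctx (S K Λ : Type*) := K → Event S K Λ

/-- The kind `t ::= c | E` of an action. -/
inductive ActKind (S K Λ : Type*)
  | prog
  | occ (E : Event S K Λ)

/-- An action label `t@κ`. -/
structure Label (S K Λ : Type*) where
  kind : ActKind S K Λ
  sys : K

/-- Environment transitions: state and event context change arbitrarily, the specification stays. -/
def EnvStep {Spec S X : Type*} (c c' : Config Spec S X) : Prop := c.spec = c'.spec

universe u v

mutual

/-- Action transitions of programs; `none` is the terminated program. -/
inductive ProgStep {S : Type u} {X : Type v} :
    Config (Option (Prog S)) S X → Config (Option (Prog S)) S X → Prop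
  | basic (f : S → S) (s : S) (x : X) :
      ProgStep ⟨some (.basic f), s, x⟩ ⟨none, f s, x⟩
  | seq1 {P₁ P₂ : Prog S} {s s' : S} {x : X} :
      ProgStep ⟨some P₁, s, x⟩ ⟨none, s', x⟩ →
      ProgStep ⟨some (.seq P₁ P₂), s, x⟩ ⟨some P₂, s', x⟩
  | seq2 {P₁ P₁' P₂ : Prog S} {s s' : S} {x : X} :
      ProgStep ⟨some P₁, s, x⟩ ⟨some P₁', s', x⟩ →
      ProgStep ⟨some (.seq P₁ P₂), s, x⟩ ⟨some (.seq P₁' P₂), s', x⟩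
  | condT {b : Set S} {P₁ P₂ : Prog S} {s : S} {x : X} : s ∈ b →
      ProgStep ⟨some (.cond b P₁ P₂), s, x⟩ ⟨some P₁, s, x⟩
  | condF {b : Set S} {P₁ P₂ : Prog S} {s : S} {x : X} : s ∉ b →
      ProgStep ⟨some (.cond b P₁ P₂), s, x⟩ ⟨some P₂, s, x⟩
  | whileF {b : Set S} {P : Prog S} {s : S} {x : X} : s ∉ b →
      ProgStep ⟨some (.while b P), s, x⟩ ⟨none, s, x⟩
  | whileT {b : Set S} {P : Prog S} {s : S} {x : X} : s ∈ b →
      ProgStep ⟨some (.while b P), s, x⟩ ⟨some (.seq P (.while b P)), s, x⟩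
  | await {b : Set S} {P : Prog S} {s s' : S} {x : X} : s ∈ b →
      ProgSteps ⟨some P, s, x⟩ ⟨none, s', x⟩ →
      ProgStep ⟨some (.await b P), s, x⟩ ⟨none, s', x⟩
  | nondt {r : Set (S × S)} {s s' : S} {x : X} : (s, s') ∈ r →
      ProgStep ⟨some (.nondt r), s, x⟩ ⟨none, s', x⟩

/-- The reflexive transitive closure of `ProgStep`. -/
inductive ProgSteps {S : Type u} {X : Type v} :
    Config (Option (Prog S)) S X → Config (Option (Prog S)) S X → Prop
  | refl (c : Config (Option (Prog S)) S X) : ProgSteps c c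
  | tail {c₁ c₂ c₃ : Config (Option (Prog S)) S X} :
      ProgSteps c₁ c₂ → ProgStep c₂ c₃ → ProgSteps c₁ c₃

end

/-- `ProgSteps` is the reflexive transitive closure of `ProgStep`. -/
theorem progSteps_iff {S X : Type*} (c c' : Config (Option (Prog S)) S X) :
    ProgSteps c c' ↔ Relation.ReflTransGen ProgStep c c' := by
  constructor
  · intro h
    exact ProgSteps.rec (motive_1 := fun _ _ _ => True)
      (motive_2 := fun a b _ => Relation.ReflTransGen ProgStep a b)
      (by intros; trivial) (by intros; trivial) (by intros; trivial) (by intros; trivial)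
      (by intros; trivial) (by intros; trivial) (by intros; trivial) (by intros; trivial)
      (by intros; trivial) (fun _ => .refl) (fun _ hs ih _ => ih.tail hs) h
  · intro h
    induction h with
    | refl => exact .refl c
    | tail _ h ih => exact ih.tail h

open Classical in
/-- Action transitions of events. -/
inductive EventStep {S K Λ : Type*} : Label S K Λ →
    Config (Event S K Λ) S (Ctx S K Λ) → Config (Event S K Λ) S (Ctx S K Λ) → Prop
  | anonyEvt {P P' : Option (Prog S)} {s s' : S} {x : Ctx S K Λ} (κ : K) :
      ProgStep ⟨P, s, x⟩ ⟨P', s', x⟩ →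
      EventStep ⟨.prog, κ⟩ ⟨.anon P, s, x⟩ ⟨.anon P', s', x⟩
  | basicEvt {α : Λ × K → Set S × Prog S} {s : S} {x : Ctx S K Λ} (p : Λ) (κ : K) :
      s ∈ (α (p, κ)).1 →
      EventStep ⟨.occ (.basic α), κ⟩ ⟨.basic α, s, x⟩
        ⟨.anon (some (α (p, κ)).2), s, Function.update x κ (.basic α)⟩

/-- Action transitions of event systems. -/
inductive SysStep {S K Λ : Type*} : Label S K Λ →
    Config (EventSys S K Λ) S (Ctx S K Λ) → Config (EventSys S K Λ) S (Ctx S K Λ) → Prop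
  | evtSet {n : ℕ} {E : Fin (n + 1) → Event S K Λ} {E' : Event S K Λ} {s : S}
      {x x' : Ctx S K Λ} {κ : K} (i : Fin (n + 1)) :
      EventStep ⟨.occ (E i), κ⟩ ⟨E i, s, x⟩ ⟨E', s, x'⟩ →
      SysStep ⟨.occ (E i), κ⟩ ⟨.evtSet n E, s, x⟩ ⟨.evtSeq E' (.evtSet n E), s, x'⟩
  | evtSeq1 {E E' : Event S K Λ} {𝒮 : EventSys S K Λ} {s s' : S} {x x' : Ctx S K Λ}
      {δ : Label S K Λ} :
      EventStep δ ⟨E, s, x⟩ ⟨E', s', x'⟩ →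
      SysStep δ ⟨.evtSeq E 𝒮, s, x⟩ ⟨.evtSeq E' 𝒮, s', x'⟩
  | evtSeq2 {E : Event S K Λ} {𝒮 : EventSys S K Λ} {s s' : S} {x x' : Ctx S K Λ}
      {δ : Label S K Λ} :
      EventStep δ ⟨E, s, x⟩ ⟨.anon none, s', x'⟩ →
      SysStep δ ⟨.evtSeq E 𝒮, s, x⟩ ⟨𝒮, s', x'⟩

open Classical in
/-- Action transitions of parallel event systems. -/
inductive ParStep {S K Λ : Type*} : Label S K Λ →
    Config (ParSys S K Λ) S (Ctx S K Λ) → Config (ParSys S K Λ) S (Ctx S K Λ) → Prop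
  | par {PS : ParSys S K Λ} {𝒮' : EventSys S K Λ} {s s' : S} {x x' : Ctx S K Λ}
      {t : ActKind S K Λ} {κ : K} :
      SysStep ⟨t, κ⟩ ⟨PS κ, s, x⟩ ⟨𝒮', s', x'⟩ →
      ParStep ⟨t, κ⟩ ⟨PS, s, x⟩ ⟨Function.update PS κ 𝒮', s', x'⟩

/-! ### Computations -/

/-- Computations: nonempty lists of configurations in which any two consecutive ones are related by
an environment transition or an action transition. -/
inductive IsComputation {L Spec S X : Type*}
    (step : L → Config Spec S X → Config Spec S X → Prop) : List (Config Spec S X) → Prop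
  | one (c : Config Spec S X) : IsComputation step [c]
  | env {c₂ c₁ : Config Spec S X} {cs : List (Config Spec S X)} :
      EnvStep c₂ c₁ → IsComputation step (c₁ :: cs) → IsComputation step (c₂ :: c₁ :: cs)
  | act {δ : L} {c₂ c₁ : Config Spec S X} {cs : List (Config Spec S X)} :
      step δ c₂ c₁ → IsComputation step (c₁ :: cs) → IsComputation step (c₂ :: c₁ :: cs)

/-- `Ψ(♯, s, x)`: the computations starting in the configuration `(♯, s, x)`. -/
def computationsFrom {L Spec S X : Type*} (step : L → Config Spec S X → Config Spec S X → Prop)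
    (sp : Spec) (s : S) (x : X) : Set (List (Config Spec S X)) :=
  {w | IsComputation step w ∧ w.head? = some ⟨sp, s, x⟩}

/-! ### Rely-guarantee specifications and validity -/

/-- A rely-guarantee specification `⟨pre, R, G, pst⟩`. -/
structure RGCond (S : Type*) where
  pre : Set S
  rely : Set (S × S)
  guar : Set (S × S)
  pst : Set S

/-- The assumption `A(pre, R)`. -/
def assume {Spec S X : Type*} (pre : Set S) (R : Set (S × S)) : Set (List (Config Spec S X)) :=
  {w | (∃ c, w.head? = some c ∧ c.state ∈ pre) ∧
    ∀ (i : ℕ) (h : i + 1 < w.length), EnvStep w[i] w[i + 1] → (w[i].state, w[i + 1].state) ∈ R}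

/-- The commitment `C(G, pst)` for parallel event systems.  These are regarded as running forever,
so that no condition is put on the final state. -/
def commitPar {S K Λ : Type*} (G : Set (S × S)) (_pst : Set S) :
    Set (List (Config (ParSys S K Λ) S (Ctx S K Λ))) :=
  {w | ∀ (i : ℕ) (h : i + 1 < w.length), ∀ δ : Label S K Λ,
    ParStep δ w[i] w[i + 1] → (w[i].state, w[i + 1].state) ∈ G}

/-- Validity `⊨ PS sat ⟨pre, R, G, pst⟩`. -/
def ParValid {S K Λ : Type*} (PS : ParSys S K Λ) (rg : RGCond S) : Prop :=
  ∀ (s : S) (x : Ctx S K Λ),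
    computationsFrom ParStep PS s x ∩ assume rg.pre rg.rely ⊆ commitPar rg.guar rg.pst

/-! ### The proof system -/

/-- `stable(p, R)`: the set `p` is closed under `R`. -/
def Stable {S : Type*} (p : Set S) (R : Set (S × S)) : Prop :=
  ∀ s s', s ∈ p → (s, s') ∈ R → s' ∈ p

/-- Derivability `⊢ P sat ⟨pre, R, G, pst⟩` for programs. -/
inductive ProgDerivable {S : Type*} : Prog S → RGCond S → Prop
  | basic {f : S → S} {pre pst : Set S} {R G : Set (S × S)} :
      pre ⊆ {s | f s ∈ pst} → Stable pre R → Stable pst R →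
      {q : S × S | q.1 ∈ pre ∧ (q.2 = f q.1 ∨ q.2 = q.1)} ⊆ G →
      ProgDerivable (.basic f) ⟨pre, R, G, pst⟩
  | seq {P Q : Prog S} {pre m pst : Set S} {R G : Set (S × S)} :
      ProgDerivable P ⟨pre, R, G, m⟩ → ProgDerivable Q ⟨m, R, G, pst⟩ →
      ProgDerivable (.seq P Q) ⟨pre, R, G, pst⟩
  | cond {b : Set S} {P₁ P₂ : Prog S} {pre pst : Set S} {R G : Set (S × S)} :
      Stable pre R → ProgDerivable P₁ ⟨pre ∩ b, R, G, pst⟩ →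
      ProgDerivable P₂ ⟨pre ∩ bᶜ, R, G, pst⟩ → (∀ s, (s, s) ∈ G) →
      ProgDerivable (.cond b P₁ P₂) ⟨pre, R, G, pst⟩
  | while {b : Set S} {P : Prog S} {pre pst : Set S} {R G : Set (S × S)} :
      Stable pre R → pre ∩ bᶜ ⊆ pst → Stable pst R →
      ProgDerivable P ⟨pre ∩ b, R, G, pre⟩ → (∀ s, (s, s) ∈ G) →
      ProgDerivable (.while b P) ⟨pre, R, G, pst⟩
  | await {b : Set S} {P : Prog S} {pre pst : Set S} {R G : Set (S × S)} :
      (∀ V : S, ProgDerivable P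
        ⟨pre ∩ b ∩ {V}, {q | q.1 = q.2}, Set.univ, {s | (V, s) ∈ G} ∩ pst⟩) →
      Stable pre R → Stable pst R →
      ProgDerivable (.await b P) ⟨pre, R, G, pst⟩
  | nondt {r : Set (S × S)} {pre pst : Set S} {R G : Set (S × S)} :
      pre ⊆ {s | (∀ s', (s, s') ∈ r → s' ∈ pst) ∧ ∃ s', (s, s') ∈ r} →
      {q : S × S | q.1 ∈ pre ∧ q ∈ r} ⊆ G → Stable pre R → Stable pst R →
      ProgDerivable (.nondt r) ⟨pre, R, G, pst⟩
  | conseq {P : Prog S} {pre pre' pst pst' : Set S} {R R' G G' : Set (S × S)} :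
      pre ⊆ pre' → R ⊆ R' → G' ⊆ G → pst' ⊆ pst →
      ProgDerivable P ⟨pre', R', G', pst'⟩ → ProgDerivable P ⟨pre, R, G, pst⟩

/-- Derivability for events. -/
inductive EventDerivable {S K Λ : Type*} : Event S K Λ → RGCond S → Prop
  | anonyEvt {P : Prog S} {pre pst : Set S} {R G : Set (S × S)} :
      ProgDerivable P ⟨pre, R, G, pst⟩ → EventDerivable (.anon (some P)) ⟨pre, R, G, pst⟩
  | basicEvt {α : Λ × K → Set S × Prog S} {pre pst : Set S} {R G : Set (S × S)} :
      (∀ (p : Λ) (κ : K), ProgDerivable (α (p, κ)).2 ⟨pre ∩ (α (p, κ)).1, R, G, pst⟩) →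
      Stable pre R → (∀ s, (s, s) ∈ G) →
      EventDerivable (.basic α) ⟨pre, R, G, pst⟩
  | conseq {E : Event S K Λ} {pre pre' pst pst' : Set S} {R R' G G' : Set (S × S)} :
      pre ⊆ pre' → R ⊆ R' → G' ⊆ G → pst' ⊆ pst →
      EventDerivable E ⟨pre', R', G', pst'⟩ → EventDerivable E ⟨pre, R, G, pst⟩

/-- Derivability for event systems. -/
inductive SysDerivable {S K Λ : Type*} : EventSys S K Λ → RGCond S → Prop
  | evtSeq {E : Event S K Λ} {𝒮 : EventSys S K Λ} {pre m pst : Set S} {R G : Set (S × S)} :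
      EventDerivable E ⟨pre, R, G, m⟩ → SysDerivable 𝒮 ⟨m, R, G, pst⟩ →
      SysDerivable (.evtSeq E 𝒮) ⟨pre, R, G, pst⟩
  | evtSet {n : ℕ} {E : Fin (n + 1) → Event S K Λ} {pre pst : Set S} {R G : Set (S × S)}
      (pres psts : Fin (n + 1) → Set S) (Rs Gs : Fin (n + 1) → Set (S × S)) :
      (∀ i, EventDerivable (E i) ⟨pres i, Rs i, Gs i, psts i⟩) →
      (∀ i, pre ⊆ pres i) → (∀ i, R ⊆ Rs i) → (∀ i, Gs i ⊆ G) → (∀ i, psts i ⊆ pst) →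
      (∀ i j, psts i ⊆ pres j) → Stable pre R → (∀ s, (s, s) ∈ G) →
      SysDerivable (.evtSet n E) ⟨pre, R, G, pst⟩
  | conseq {𝒮 : EventSys S K Λ} {pre pre' pst pst' : Set S} {R R' G G' : Set (S × S)} :
      pre ⊆ pre' → R ⊆ R' → G' ⊆ G → pst' ⊆ pst →
      SysDerivable 𝒮 ⟨pre', R', G', pst'⟩ → SysDerivable 𝒮 ⟨pre, R, G, pst⟩

/-- Derivability for parallel event systems. -/
inductive ParDerivable {S K Λ : Type*} : ParSys S K Λ → RGCond S → Prop
  | par {PS : ParSys S K Λ} {pre pst : Set S} {R G : Set (S × S)}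
      (pres psts : K → Set S) (Rs Gs : K → Set (S × S)) :
      (∀ κ, SysDerivable (PS κ) ⟨pres κ, Rs κ, Gs κ, psts κ⟩) →
      (∀ κ, pre ⊆ pres κ) → (∀ κ, R ⊆ Rs κ) → (∀ κ, Gs κ ⊆ G) → (∀ κ, psts κ ⊆ pst) →
      (∀ κ κ', κ ≠ κ' → Gs κ ⊆ Rs κ') →
      ParDerivable PS ⟨pre, R, G, pst⟩
  | conseq {PS : ParSys S K Λ} {pre pre' pst pst' : Set S} {R R' G G' : Set (S × S)} :
      pre ⊆ pre' → R ⊆ R' → G' ⊆ G → pst' ⊆ pst →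
      ParDerivable PS ⟨pre', R', G', pst'⟩ → ParDerivable PS ⟨pre, R, G, pst⟩

end EventLang

/-!
Soundness is proved by subject reduction for derivability. Every derivable precondition can be
enlarged to one that is stable under the rely (`ProgDerivable.exists_stable` and its analogues for
events and event systems), so an environment transition keeps the current state inside the
precondition of some derivation with the same rely, guarantee and postcondition. An action
transition out of a derivable specification lies in the guarantee and leads either to termination
in the postcondition or to a specification that is derivable again, with a precondition holding in
the new state (`progOk_of_progStep`, `eventOk_of_eventStep`, `sysOk_of_sysStep`). For programs this
goes by induction on the transition and not on the derivation: the body of an `await` runs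
through reducts which are not subprograms.

For a parallel event system the invariant is that every component is derivable in this sense for
its own specification. An action of component `κ` is in `Gs κ`, so it is an action within the
guarantee for `κ` and an environment transition within the rely for every other component
(`ParDerivable.exists_components`, `parInv_of_parStep`).
-/

namespace EventLang

/-! ### Derivability of programs -/

section Prog

variable {S : Type*} {P P₁ P₂ : Prog S} {b pst : Set S} {R G : Set (S × S)} {s : S}

/-- The given precondition need not itself be stable: `conseq` may have shrunk it. -/
theorem ProgDerivable.exists_stable {rg : RGCond S} (h : ProgDerivable P rg) :
    ∃ pre', rg.pre ⊆ pre' ∧ Stable pre' rg.rely ∧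
      ProgDerivable P ⟨pre', rg.rely, rg.guar, rg.pst⟩ := by
  induction h with
  | basic h₁ h₂ h₃ h₄ => exact ⟨_, subset_rfl, h₂, .basic h₁ h₂ h₃ h₄⟩
  | seq _ hQ ihP _ =>
    obtain ⟨pre', hsub, hst, hP⟩ := ihP
    exact ⟨pre', hsub, hst, .seq hP hQ⟩
  | cond h₁ h₂ h₃ h₄ => exact ⟨_, subset_rfl, h₁, .cond h₁ h₂ h₃ h₄⟩
  | await h₁ h₂ h₃ => exact ⟨_, subset_rfl, h₂, .await h₁ h₂ h₃⟩
  | nondt h₁ h₂ h₃ h₄ => exact ⟨_, subset_rfl, h₃, .nondt h₁ h₂ h₃ h₄⟩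
  | conseq hpre hR hG hpst _ ih =>
    obtain ⟨pre', hsub, hst, hP⟩ := ih
    exact ⟨pre', hpre.trans hsub, fun s s' hs hr => hst s s' hs (hR hr),
      .conseq subset_rfl hR hG hpst hP⟩
  | _ =>
    -- The remaining rule is that for `while`, whose name is a keyword.
    rename_i h₁ h₂ h₃ h₄ h₅ _
    exact ⟨_, subset_rfl, h₁, .while h₁ h₂ h₃ h₄ h₅⟩

theorem ProgDerivable.basic_inv {f : S → S} {rg : RGCond S} (h : ProgDerivable (.basic f) rg)
    (hs : s ∈ rg.pre) : (s, f s) ∈ rg.guar ∧ f s ∈ rg.pst := by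
  generalize hP : Prog.basic f = P at h
  induction h with
  | basic h₁ _ _ h₄ => cases hP; exact ⟨h₄ ⟨hs, .inl rfl⟩, h₁ hs⟩
  | conseq hpre _ hG hpst _ ih => exact ⟨hG (ih (hpre hs) hP).1, hpst (ih (hpre hs) hP).2⟩
  | _ => cases hP

theorem ProgDerivable.nondt_inv {r : Set (S × S)} {rg : RGCond S}
    (h : ProgDerivable (.nondt r) rg) {s' : S} (hs : s ∈ rg.pre) (hr : (s, s') ∈ r) :
    (s, s') ∈ rg.guar ∧ s' ∈ rg.pst := by
  generalize hP : Prog.nondt r = P at h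
  induction h with
  | nondt h₁ h₂ => cases hP; exact ⟨h₂ ⟨hs, hr⟩, (h₁ hs).1 _ hr⟩
  | conseq hpre _ hG hpst _ ih => exact ⟨hG (ih (hpre hs) hP).1, hpst (ih (hpre hs) hP).2⟩
  | _ => cases hP

theorem ProgDerivable.seq_inv {rg : RGCond S} (h : ProgDerivable (.seq P₁ P₂) rg) :
    ∃ m, ProgDerivable P₁ ⟨rg.pre, rg.rely, rg.guar, m⟩ ∧
      ProgDerivable P₂ ⟨m, rg.rely, rg.guar, rg.pst⟩ := by
  generalize hP : Prog.seq P₁ P₂ = P at h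
  induction h with
  | seq h₁ h₂ => cases hP; exact ⟨_, h₁, h₂⟩
  | conseq hpre hR hG hpst _ ih =>
    obtain ⟨m, h₁, h₂⟩ := ih hP
    exact ⟨m, .conseq hpre hR hG subset_rfl h₁, .conseq subset_rfl hR hG hpst h₂⟩
  | _ => cases hP

theorem ProgDerivable.cond_inv {rg : RGCond S} (h : ProgDerivable (.cond b P₁ P₂) rg) :
    ProgDerivable P₁ ⟨rg.pre ∩ b, rg.rely, rg.guar, rg.pst⟩ ∧
      ProgDerivable P₂ ⟨rg.pre ∩ bᶜ, rg.rely, rg.guar, rg.pst⟩ ∧ ∀ s, (s, s) ∈ rg.guar := by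
  generalize hP : Prog.cond b P₁ P₂ = P at h
  induction h with
  | cond _ h₁ h₂ h₃ => cases hP; exact ⟨h₁, h₂, h₃⟩
  | conseq hpre hR hG hpst _ ih =>
    obtain ⟨h₁, h₂, h₃⟩ := ih hP
    exact ⟨.conseq (Set.inter_subset_inter_left _ hpre) hR hG hpst h₁,
      .conseq (Set.inter_subset_inter_left _ hpre) hR hG hpst h₂, fun s => hG (h₃ s)⟩
  | _ => cases hP

/-- A derivable loop has a loop invariant. -/
theorem ProgDerivable.while_inv {rg : RGCond S} (h : ProgDerivable (.while b P) rg) :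
    ∃ inv, rg.pre ⊆ inv ∧ inv ∩ bᶜ ⊆ rg.pst ∧ (∀ s, (s, s) ∈ rg.guar) ∧
      ProgDerivable P ⟨inv ∩ b, rg.rely, rg.guar, inv⟩ ∧
      ProgDerivable (.while b P) ⟨inv, rg.rely, rg.guar, rg.pst⟩ := by
  generalize hP : Prog.while b P = Q at h
  induction h with
  | conseq hpre hR hG hpst _ ih =>
    obtain ⟨inv, h₁, h₂, h₃, h₄, h₅⟩ := ih hP
    exact ⟨inv, hpre.trans h₁, h₂.trans hpst, fun s => hG (h₃ s),
      .conseq subset_rfl hR hG subset_rfl h₄, .conseq subset_rfl hR hG hpst h₅⟩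
  | basic | seq | cond | await | nondt => cases hP
  | _ =>
    rename_i h₁ h₂ h₃ h₄ h₅ _
    cases hP
    exact ⟨_, subset_rfl, h₂, h₅, h₄, .while h₁ h₂ h₃ h₄ h₅⟩

theorem ProgDerivable.await_inv {rg : RGCond S} (h : ProgDerivable (.await b P) rg) (V : S) :
    ProgDerivable P ⟨rg.pre ∩ b ∩ {V}, {q | q.1 = q.2}, Set.univ,
      {s | (V, s) ∈ rg.guar} ∩ rg.pst⟩ := by
  generalize hP : Prog.await b P = Q at h
  induction h with
  | await h₁ => cases hP; exact h₁ V
  | conseq hpre _ hG hpst _ ih =>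
    exact .conseq (Set.inter_subset_inter_left _ (Set.inter_subset_inter_left _ hpre)) subset_rfl
      subset_rfl (Set.inter_subset_inter (fun _ h => hG h) hpst) (ih hP)
  | _ => cases hP

/-- A program, possibly terminated, in a state from which it respects the rely `R`, the guarantee
`G` and the postcondition `pst`: either it has terminated in `pst`, or it is derivable for some
precondition that holds in the state. -/
def ProgOk (R G : Set (S × S)) (pst : Set S) : Option (Prog S) → S → Prop
  | none, s => s ∈ pst
  | some P, s => ∃ pre, s ∈ pre ∧ ProgDerivable P ⟨pre, R, G, pst⟩

/-- Subject reduction for programs, by mutual induction on single transitions and on their closure;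
only the latter, needed for `await`, loses the guarantee. -/
theorem progOk_of_progStep {X : Type*} {c c' : Config (Option (Prog S)) S X}
    (h : ProgStep c c') (hok : ProgOk R G pst c.spec c.state) :
    (c.state, c'.state) ∈ G ∧ ProgOk R G pst c'.spec c'.state := by
  refine ProgStep.rec
    (motive_1 := fun c c' _ => ∀ (R G : Set (S × S)) (pst : Set S),
      ProgOk R G pst c.spec c.state →
        (c.state, c'.state) ∈ G ∧ ProgOk R G pst c'.spec c'.state)
    (motive_2 := fun c c' _ => ∀ (R G : Set (S × S)) (pst : Set S),
      ProgOk R G pst c.spec c.state → ProgOk R G pst c'.spec c'.state)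
    ?_ ?_ ?_ ?_ ?_ ?_ ?_ ?_ ?_ ?_ ?_ h R G pst hok
  · rintro f s x R G pst ⟨pre, hs, hP⟩
    exact hP.basic_inv hs
  · rintro P₁ P₂ s s' x _ ih R G pst ⟨pre, hs, hP⟩
    obtain ⟨m, h₁, h₂⟩ := hP.seq_inv
    obtain ⟨hG, hm⟩ := ih R G m ⟨pre, hs, h₁⟩
    exact ⟨hG, m, hm, h₂⟩
  · rintro P₁ P₁' P₂ s s' x _ ih R G pst ⟨pre, hs, hP⟩
    obtain ⟨m, h₁, h₂⟩ := hP.seq_inv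
    obtain ⟨hG, pre', hs', h₁'⟩ := ih R G m ⟨pre, hs, h₁⟩
    exact ⟨hG, pre', hs', .seq h₁' h₂⟩
  · rintro b P₁ P₂ s x hb R G pst ⟨pre, hs, hP⟩
    obtain ⟨h₁, -, hid⟩ := hP.cond_inv
    exact ⟨hid s, pre ∩ b, ⟨hs, hb⟩, h₁⟩
  · rintro b P₁ P₂ s x hb R G pst ⟨pre, hs, hP⟩
    obtain ⟨-, h₂, hid⟩ := hP.cond_inv
    exact ⟨hid s, pre ∩ bᶜ, ⟨hs, hb⟩, h₂⟩
  · rintro b P s x hb R G pst ⟨pre, hs, hP⟩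
    obtain ⟨inv, hsub, hexit, hid, -, -⟩ := hP.while_inv
    exact ⟨hid s, hexit ⟨hsub hs, hb⟩⟩
  · rintro b P s x hb R G pst ⟨pre, hs, hP⟩
    obtain ⟨inv, hsub, -, hid, hbody, hloop⟩ := hP.while_inv
    exact ⟨hid s, inv ∩ b, ⟨hsub hs, hb⟩, .seq hbody hloop⟩
  · rintro b P s s' x hb _ ih R G pst ⟨pre, hs, hP⟩
    -- Termination of the body in its postcondition `{s' | (s, s') ∈ G} ∩ pst` is the whole claim.
    exact ih _ _ _ ⟨pre ∩ b ∩ {s}, ⟨⟨hs, hb⟩, rfl⟩, hP.await_inv s⟩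
  · rintro r s s' x hr R G pst ⟨pre, hs, hP⟩
    exact hP.nondt_inv hs hr
  · exact fun _ _ _ _ h => h
  · exact fun _ _ ih₁ ih₂ R G pst hok => (ih₂ R G pst (ih₁ R G pst hok)).2

end Prog

/-! ### Derivability of events -/

section Event

variable {S K Λ : Type*} {E : Event S K Λ} {pst : Set S} {R G : Set (S × S)}

theorem EventDerivable.exists_stable {rg : RGCond S} (h : EventDerivable E rg) :
    ∃ pre', rg.pre ⊆ pre' ∧ Stable pre' rg.rely ∧
      EventDerivable E ⟨pre', rg.rely, rg.guar, rg.pst⟩ := by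
  induction h with
  | anonyEvt hP =>
    obtain ⟨pre', hsub, hst, hP'⟩ := hP.exists_stable
    exact ⟨pre', hsub, hst, .anonyEvt hP'⟩
  | basicEvt h₁ h₂ h₃ => exact ⟨_, subset_rfl, h₂, .basicEvt h₁ h₂ h₃⟩
  | conseq hpre hR hG hpst _ ih =>
    obtain ⟨pre', hsub, hst, hE⟩ := ih
    exact ⟨pre', hpre.trans hsub, fun s s' hs hr => hst s s' hs (hR hr),
      .conseq subset_rfl hR hG hpst hE⟩

theorem EventDerivable.anon_inv {P : Option (Prog S)} {rg : RGCond S}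
    (h : EventDerivable (.anon P : Event S K Λ) rg) :
    ∃ Q, P = some Q ∧ ProgDerivable Q rg := by
  generalize hE : Event.anon P = E at h
  induction h with
  | anonyEvt hP => cases hE; exact ⟨_, rfl, hP⟩
  | basicEvt => cases hE
  | conseq hpre hR hG hpst _ ih =>
    obtain ⟨Q, hQ, hder⟩ := ih hE
    exact ⟨Q, hQ, .conseq hpre hR hG hpst hder⟩

theorem EventDerivable.basic_inv {α : Λ × K → Set S × Prog S} {rg : RGCond S}
    (h : EventDerivable (.basic α) rg) :
    (∀ p κ, ProgDerivable (α (p, κ)).2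
      ⟨rg.pre ∩ (α (p, κ)).1, rg.rely, rg.guar, rg.pst⟩) ∧ ∀ s, (s, s) ∈ rg.guar := by
  generalize hE : Event.basic α = E at h
  induction h with
  | anonyEvt => cases hE
  | basicEvt h₁ _ h₃ => cases hE; exact ⟨h₁, h₃⟩
  | conseq hpre hR hG hpst _ ih =>
    obtain ⟨h₁, h₂⟩ := ih hE
    exact ⟨fun p κ => .conseq (Set.inter_subset_inter_left _ hpre) hR hG hpst (h₁ p κ),
      fun s => hG (h₂ s)⟩

/-- An event in a state from which it respects the rely `R`, the guarantee `G` and the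
postcondition `pst`: either it has terminated in `pst`, or it is derivable for some precondition
that holds in the state. -/
def EventOk (R G : Set (S × S)) (pst : Set S) (E : Event S K Λ) (s : S) : Prop :=
  (E = .anon none ∧ s ∈ pst) ∨ ∃ pre, s ∈ pre ∧ EventDerivable E ⟨pre, R, G, pst⟩

theorem eventOk_of_eventStep {δ : Label S K Λ} {c c' : Config (Event S K Λ) S (Ctx S K Λ)}
    (h : EventStep δ c c') {pre : Set S} (hs : c.state ∈ pre)
    (hE : EventDerivable c.spec ⟨pre, R, G, pst⟩) :
    (c.state, c'.state) ∈ G ∧ EventOk R G pst c'.spec c'.state := by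
  cases h with
  | @anonyEvt P P' s s' x κ hstep =>
    obtain ⟨Q, rfl, hQ⟩ := hE.anon_inv
    obtain ⟨hG, hok⟩ := progOk_of_progStep hstep ⟨pre, hs, hQ⟩
    refine ⟨hG, ?_⟩
    cases P' with
    | none => exact .inl ⟨rfl, hok⟩
    | some P' =>
      obtain ⟨pre', hs', hder⟩ := hok
      exact .inr ⟨pre', hs', .anonyEvt hder⟩
  | @basicEvt α s x p κ hguard =>
    obtain ⟨hbody, hid⟩ := hE.basic_inv
    exact ⟨hid _, .inr ⟨pre ∩ (α (p, κ)).1, ⟨hs, hguard⟩, .anonyEvt (hbody p κ)⟩⟩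

end Event

/-! ### Derivability of event systems -/

section Sys

variable {S K Λ : Type*} {𝒮 : EventSys S K Λ} {pst : Set S} {R G : Set (S × S)}

theorem SysDerivable.exists_stable {rg : RGCond S} (h : SysDerivable 𝒮 rg) :
    ∃ pre', rg.pre ⊆ pre' ∧ Stable pre' rg.rely ∧
      SysDerivable 𝒮 ⟨pre', rg.rely, rg.guar, rg.pst⟩ := by
  induction h with
  | evtSeq hE hS _ =>
    obtain ⟨pre', hsub, hst, hE'⟩ := hE.exists_stable
    exact ⟨pre', hsub, hst, .evtSeq hE' hS⟩
  | evtSet pres psts Rs Gs h₁ h₂ h₃ h₄ h₅ h₆ h₇ h₈ =>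
    exact ⟨_, subset_rfl, h₇, .evtSet pres psts Rs Gs h₁ h₂ h₃ h₄ h₅ h₆ h₇ h₈⟩
  | conseq hpre hR hG hpst _ ih =>
    obtain ⟨pre', hsub, hst, hS⟩ := ih
    exact ⟨pre', hpre.trans hsub, fun s s' hs hr => hst s s' hs (hR hr),
      .conseq subset_rfl hR hG hpst hS⟩

theorem SysDerivable.evtSeq_inv {E : Event S K Λ} {rg : RGCond S}
    (h : SysDerivable (.evtSeq E 𝒮) rg) :
    ∃ m, EventDerivable E ⟨rg.pre, rg.rely, rg.guar, m⟩ ∧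
      SysDerivable 𝒮 ⟨m, rg.rely, rg.guar, rg.pst⟩ := by
  generalize hT : EventSys.evtSeq E 𝒮 = T at h
  induction h with
  | evtSeq h₁ h₂ => cases hT; exact ⟨_, h₁, h₂⟩
  | evtSet => cases hT
  | conseq hpre hR hG hpst _ ih =>
    obtain ⟨m, h₁, h₂⟩ := ih hT
    exact ⟨m, .conseq hpre hR hG subset_rfl h₁, .conseq subset_rfl hR hG hpst h₂⟩

/-- A derivable event set has an invariant `inv` which every event reestablishes on termination and
from which the event set is derivable again, so that the set can be iterated. -/
theorem SysDerivable.evtSet_inv {n : ℕ} {E : Fin (n + 1) → Event S K Λ} {rg : RGCond S}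
    (h : SysDerivable (.evtSet n E) rg) :
    ∃ inv, (∀ i, EventDerivable (E i) ⟨rg.pre, rg.rely, rg.guar, inv⟩) ∧
      SysDerivable (.evtSet n E) ⟨inv, rg.rely, rg.guar, rg.pst⟩ := by
  generalize hT : EventSys.evtSet n E = T at h
  induction h with
  | evtSeq => cases hT
  | evtSet pres psts Rs Gs h₁ h₂ h₃ h₄ h₅ h₆ _ h₈ =>
    cases hT
    -- The rule asks for a precondition stable under the rely; the `pres i` need not be stable, but
    -- the intersection of their stable enlargements is.
    choose pres' hsub hst hder using fun i => (h₁ i).exists_stable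
    refine ⟨⋂ i, pres' i, fun i => ?_, ?_⟩
    · exact .conseq (h₂ i) (h₃ i) (h₄ i)
        (Set.subset_iInter fun j => (h₆ i j).trans (hsub j)) (h₁ i)
    · refine .evtSet pres' psts Rs Gs hder (Set.iInter_subset _) h₃ h₄ h₅
        (fun i j => (h₆ i j).trans (hsub j)) ?_ h₈
      intro s s' hs hr
      rw [Set.mem_iInter] at hs ⊢
      exact fun i => hst i s s' (hs i) (h₃ i hr)
  | conseq hpre hR hG hpst _ ih =>
    obtain ⟨inv, h₁, h₂⟩ := ih hT
    exact ⟨inv, fun i => .conseq hpre hR hG subset_rfl (h₁ i),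
      .conseq subset_rfl hR hG hpst h₂⟩

/-- An event system in a state from which it respects the rely `R`, the guarantee `G` and the
postcondition `pst`: either it is derivable for some precondition that holds in the state, or its
first event is the terminated program. In the latter case, reached by the rule which keeps a
terminated event in the sequence, the event system has no action at all. -/
def SysOk (R G : Set (S × S)) (pst : Set S) (𝒮 : EventSys S K Λ) (s : S) : Prop :=
  (∃ pre, s ∈ pre ∧ SysDerivable 𝒮 ⟨pre, R, G, pst⟩) ∨ ∃ 𝒮', 𝒮 = .evtSeq (.anon none) 𝒮'

theorem SysOk.env {s s' : S} (h : SysOk R G pst 𝒮 s) (hr : (s, s') ∈ R) :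
    SysOk R G pst 𝒮 s' := by
  refine h.imp_left ?_
  rintro ⟨pre, hs, hS⟩
  obtain ⟨pre', hsub, hst, hS'⟩ := hS.exists_stable
  exact ⟨pre', hst s s' (hsub hs) hr, hS'⟩

theorem not_eventStep_anon_none {δ : Label S K Λ} {s : S} {x : Ctx S K Λ}
    {c : Config (Event S K Λ) S (Ctx S K Λ)} : ¬ EventStep δ ⟨.anon none, s, x⟩ c := by
  rintro (⟨_, h⟩ | _)
  cases h

theorem SysOk.evtSeq {E : Event S K Λ} {m : Set S} {s : S} (hE : EventOk R G m E s)
    (hS : SysDerivable 𝒮 ⟨m, R, G, pst⟩) : SysOk R G pst (.evtSeq E 𝒮) s := by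
  obtain ⟨rfl, -⟩ | ⟨pre, hs, hder⟩ := hE
  · exact .inr ⟨_, rfl⟩
  · exact .inl ⟨pre, hs, .evtSeq hder hS⟩

theorem sysOk_of_sysStep {δ : Label S K Λ} {c c' : Config (EventSys S K Λ) S (Ctx S K Λ)}
    (h : SysStep δ c c') (hok : SysOk R G pst c.spec c.state) :
    (c.state, c'.state) ∈ G ∧ SysOk R G pst c'.spec c'.state := by
  obtain ⟨pre, hs, hS⟩ | ⟨𝒮', heq⟩ := hok
  · cases h with
    | evtSet i hstep =>
      obtain ⟨inv, hE, hset⟩ := hS.evtSet_inv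
      obtain ⟨hG, hE'⟩ := eventOk_of_eventStep hstep hs (hE i)
      exact ⟨hG, .evtSeq hE' hset⟩
    | evtSeq1 hstep =>
      obtain ⟨m, hE, hS'⟩ := hS.evtSeq_inv
      obtain ⟨hG, hE'⟩ := eventOk_of_eventStep hstep hs hE
      exact ⟨hG, .evtSeq hE' hS'⟩
    | evtSeq2 hstep =>
      obtain ⟨m, hE, hS'⟩ := hS.evtSeq_inv
      obtain ⟨hG, ⟨-, hm⟩ | ⟨_, _, hnone⟩⟩ := eventOk_of_eventStep hstep hs hE
      · exact ⟨hG, .inl ⟨m, hm, hS'⟩⟩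
      · obtain ⟨_, h, -⟩ := hnone.anon_inv
        cases h
  · cases h with
    | evtSet => cases heq
    | evtSeq1 hstep => cases heq; exact (not_eventStep_anon_none hstep).elim
    | evtSeq2 hstep => cases heq; exact (not_eventStep_anon_none hstep).elim

end Sys

/-! ### Parallel event systems -/

section Par

variable {S K Λ : Type*} {PS : ParSys S K Λ} {R G : Set (S × S)}

theorem ParDerivable.exists_components {rg : RGCond S} (h : ParDerivable PS rg) :
    ∃ (psts : K → Set S) (Rs Gs : K → Set (S × S)),
      (∀ κ, SysDerivable (PS κ) ⟨rg.pre, Rs κ, Gs κ, psts κ⟩) ∧ (∀ κ, rg.rely ⊆ Rs κ) ∧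
      (∀ κ, Gs κ ⊆ rg.guar) ∧ ∀ κ κ', κ ≠ κ' → Gs κ ⊆ Rs κ' := by
  induction h with
  | par pres psts Rs Gs h₁ h₂ h₃ h₄ _ h₆ =>
    exact ⟨psts, Rs, Gs, fun κ => .conseq (h₂ κ) subset_rfl subset_rfl subset_rfl (h₁ κ),
      h₃, h₄, h₆⟩
  | conseq hpre hR hG _ _ ih =>
    obtain ⟨psts, Rs, Gs, h₁, h₂, h₃, h₄⟩ := ih
    exact ⟨psts, Rs, Gs, fun κ => .conseq hpre subset_rfl subset_rfl subset_rfl (h₁ κ),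
      fun κ => hR.trans (h₂ κ), fun κ => (h₃ κ).trans hG, h₄⟩

/-- The invariant of the computations of a parallel event system: every component respects its own
rely, guarantee and postcondition from the current state on. -/
def ParInv (Rs Gs : K → Set (S × S)) (psts : K → Set S)
    (c : Config (ParSys S K Λ) S (Ctx S K Λ)) : Prop :=
  ∀ κ, SysOk (Rs κ) (Gs κ) (psts κ) (c.spec κ) c.state

variable {psts : K → Set S} {Rs Gs : K → Set (S × S)}
  {c c' : Config (ParSys S K Λ) S (Ctx S K Λ)}

theorem parInv_of_envStep (hR : ∀ κ, R ⊆ Rs κ) (hinv : ParInv Rs Gs psts c)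
    (h : EnvStep c c') (hr : (c.state, c'.state) ∈ R) : ParInv Rs Gs psts c' := by
  intro κ
  rw [← show c.spec = c'.spec from h]
  exact (hinv κ).env (hR κ hr)

theorem parInv_of_parStep (hG : ∀ κ, Gs κ ⊆ G) (hGR : ∀ κ κ', κ ≠ κ' → Gs κ ⊆ Rs κ')
    (hinv : ParInv Rs Gs psts c) {δ : Label S K Λ} (h : ParStep δ c c') :
    (c.state, c'.state) ∈ G ∧ ParInv Rs Gs psts c' := by
  classical
  cases h with
  | @par PS 𝒮' s s' x x' t κ hstep =>
    obtain ⟨hGκ, hok⟩ := sysOk_of_sysStep hstep (hinv κ)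
    refine ⟨hG κ hGκ, fun κ' => ?_⟩
    obtain rfl | hne := eq_or_ne κ' κ
    · simpa using hok
    · simpa [hne] using (hinv κ').env (hGR κ κ' hne.symm hGκ)

theorem mem_commitPar_of_parInv (hR : ∀ κ, R ⊆ Rs κ) (hG : ∀ κ, Gs κ ⊆ G)
    (hGR : ∀ κ κ', κ ≠ κ' → Gs κ ⊆ Rs κ') (pst : Set S)
    {w : List (Config (ParSys S K Λ) S (Ctx S K Λ))} (hw : IsComputation ParStep w)
    (hinv : ∀ c, w.head? = some c → ParInv Rs Gs psts c)
    (henv : ∀ (i : ℕ) (h : i + 1 < w.length), EnvStep w[i] w[i + 1] →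
      (w[i].state, w[i + 1].state) ∈ R) :
    w ∈ commitPar G pst := by
  induction hw with
  | one c =>
    intro i h
    simp at h
  | @env c₂ c₁ cs hstep _ ih =>
    have h₂ := hinv c₂ rfl
    have h₁ := parInv_of_envStep hR h₂ hstep (henv 0 (by simp) hstep)
    have htail := ih (fun c hc => by cases hc; exact h₁)
      (fun i h => henv (i + 1) (Nat.succ_lt_succ h))
    rintro (_ | i) h δ hδ
    · exact (parInv_of_parStep hG hGR h₂ hδ).1
    · exact htail i (Nat.lt_of_succ_lt_succ h) δ hδ
  | @act δ c₂ c₁ cs hstep _ ih =>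
    have h₂ := hinv c₂ rfl
    obtain ⟨hGs, h₁⟩ := parInv_of_parStep hG hGR h₂ hstep
    have htail := ih (fun c hc => by cases hc; exact h₁)
      (fun i h => henv (i + 1) (Nat.succ_lt_succ h))
    rintro (_ | i) h δ hδ
    · exact hGs
    · exact htail i (Nat.lt_of_succ_lt_succ h) δ hδ

end Par

end EventLang

theorem mainTheorem2 {S K Λ : Type*} (PS : EventLang.ParSys S K Λ)
    (pre : Set S) (R G : Set (S × S)) (pst : Set S)
    (h : EventLang.ParDerivable PS ⟨pre, R, G, pst⟩) :
    EventLang.ParValid PS ⟨pre, R, G, pst⟩ := by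
  obtain ⟨psts, Rs, Gs, hder, hR, hG, hGR⟩ := h.exists_components
  rintro s x w ⟨⟨hw, hhead⟩, ⟨c, hc, hpre⟩, henv⟩
  refine EventLang.mem_commitPar_of_parInv (psts := psts) hR hG hGR pst hw (fun c' hc' κ => ?_) henv
  obtain rfl : c = c' := Option.some.inj (hc.symm.trans hc')
  obtain rfl : c = ⟨PS, s, x⟩ := Option.some.inj (hc.symm.trans hhead)
  exact .inl ⟨pre, hpre, hder κ⟩
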